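/- Let $A=\mathbb{C}[\dots,x_{-1},y_{-1},x_0,y_0,x_1,y_1,\dots]$ be the complex algebra generated by pairwise anticommuting elements $x_i,y_i$, $i\in\mathbb{Z}$ (so $x_i^2=y_i^2=0$; that is, the exterior algebra on these symbols). The $\mathbf{SqL}$ algebra is generated by such $x_i,y_i$ with the relations (REL) $$\sum_{i\in\mathbb{Z}}x_i\,y_{-i+s}=0,\qquad \sum_{i\in\mathbb{Z}}(-1)^i\,x_i\,y_{-i+2s+1}=0\qquad(s\in\mathbb{Z}),$$ together with the action of two commuting operators $c,u$ such that $[c,x_i]=x_i$, $[c,y_i]=y_i$, $[u,x_i]=-i\,x_i$, $[u,y_i]=-i\,y_i$. The infinite sums are understood in representations where every vector is annihilated by all $x_i,y_i$ with $i$ sufficiently large, so that only finitely many terms act non-trivially on a given vector. For $N\in\mathbb{Z}$ let $\Upsilon(N)$ be the induced representation generated by an extreme vector $\gamma_N$ with $$x_i\circ\gamma_N=0\ \ (i\ge N-1),\qquad y_i\circ\gamma_N=0\ \ (i\ge N),$$ that is, the universal $A$-module of this kind satisfying (REL), generated by a vector $\gamma_N$ with these properties. **Lemma 2.** For every $N\in\mathbb{Z}$: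 (a) The vectors $$x_{i_1}x_{i_2}\cdots x_{i_l}\,y_{j_1}y_{j_2}\cdots y_{j_m}\circ\gamma_N,\qquad |i_a-j_b|\ge 2\ \text{ for all } a,b,$$ with $l,m\ge 0$, $i_1<\dots<i_l\le N-2$ and $j_1<\dots<j_m\le N-1$, are pairwise distinct and form a basis of the complex vector space $\Upsilon(N)$. (b) The homomorphism $\Upsilon(N)\to\Upsilon(N+1)$ determined by $\gamma_N\mapsto y_N\circ\gamma_{N+1}$ is well defined and injective. -/

import Mathlib

namespace SqL

/-- The algebra `ℂ[…, x₋₁, y₋₁, x₀, y₀, x₁, y₁, …]` of pairwise anticommuting variables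
`xᵢ` (index `Sum.inl i`) and `yᵢ` (index `Sum.inr i`), `i ∈ ℤ`: the exterior algebra on the
complex vector space with these symbols as a basis. -/
abbrev Fermion : Type := ExteriorAlgebra ℂ ((ℤ ⊕ ℤ) →₀ ℂ)

/-- A generator. -/
noncomputable def gen (k : ℤ ⊕ ℤ) : Fermion := ExteriorAlgebra.ι ℂ (Finsupp.single k 1)

/-- The generator `xᵢ`. -/
noncomputable def x (i : ℤ) : Fermion := gen (Sum.inl i)

/-- The generator `yᵢ`. -/
noncomputable def y (i : ℤ) : Fermion := gen (Sum.inr i)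

/-- A representation of the anticommuting variables `xᵢ, yᵢ` in which the relations
`REL` make sense and hold. Every vector is annihilated by `xᵢ` and `yᵢ` for `i ≫ 0`; as the
variables anticommute, all but finitely many terms of each of the two sums then vanish. -/
structure SatisfiesREL (V : Type*) [AddCommGroup V] [Module ℂ V] [Module Fermion V] : Prop where
  smooth : ∀ v : V, ∃ n : ℤ, ∀ i ≥ n, x i • v = 0 ∧ y i • v = 0
  rel : ∀ (s : ℤ) (v : V), ∑ᶠ i : ℤ, x i • y (-i + s) • v = 0
  rel_alt : ∀ (s : ℤ) (v : V), ∑ᶠ i : ℤ, ((-1 : ℂ) ^ i) • x i • y (-i + 2 * s + 1) • v = 0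

/-- A representation of the **SqL** algebra: the relations `REL` together with the action of the
two operators `c` and `u`. -/
structure IsSqLRep (V : Type*) [AddCommGroup V] [Module ℂ V] [Module Fermion V]
    (c u : Module.End ℂ V) : Prop extends SatisfiesREL V where
  c_u : ∀ v : V, c (u v) - u (c v) = 0
  c_x : ∀ (i : ℤ) (v : V), c (x i • v) - x i • c v = x i • v
  c_y : ∀ (i : ℤ) (v : V), c (y i • v) - y i • c v = y i • v
  u_x : ∀ (i : ℤ) (v : V), u (x i • v) - x i • u v = (-(i : ℂ)) • x i • v
  u_y : ∀ (i : ℤ) (v : V), u (y i • v) - y i • u v = (-(i : ℂ)) • y i • v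

/-- The conditions on an extreme vector of level `N`. -/
structure IsExtreme {V : Type*} [AddCommGroup V] [Module Fermion V] (N : ℤ) (v : V) : Prop where
  x_smul : ∀ i ≥ N - 1, x i • v = 0
  y_smul : ∀ i ≥ N, y i • v = 0

/-- What is left of `∑ᵢ xᵢ y₋ᵢ₊ₛ` after removal of the terms with a factor that annihilates an
extreme vector of level `N`. -/
noncomputable def relator (N s : ℤ) : Fermion :=
  ∑ i ∈ Finset.Icc (s - N + 1) (N - 2), x i * y (-i + s)

/-- What is left of `∑ᵢ (-1)ⁱ xᵢ y₋ᵢ₊₂ₛ₊₁` after removal of the terms with a factor that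
annihilates an extreme vector of level `N`. -/
noncomputable def relatorAlt (N s : ℤ) : Fermion :=
  ∑ i ∈ Finset.Icc (2 * s + 1 - N + 1) (N - 2), ((-1 : ℂ) ^ i) • (x i * y (-i + 2 * s + 1))

/-- The set of elements that annihilate the extreme vector of level `N` by definition. -/
def annSet (N : ℤ) : Set Fermion :=
  {a | (∃ i ≥ N - 1, a = x i) ∨ (∃ i ≥ N, a = y i) ∨ (∃ s, a = relator N s) ∨
    (∃ s, a = relatorAlt N s)}

/-- The left ideal generated by these elements. -/
noncomputable def ann (N : ℤ) : Submodule Fermion Fermion := Submodule.span Fermion (annSet N)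

/-- The induced representation `Υ(N)`. It is characterized by `Upsilon.isSqLRep`,
`extremeVector_isExtreme` and `Upsilon.existsUnique_lift` below. -/
abbrev Upsilon (N : ℤ) : Type := Fermion ⧸ ann N

/-- The extreme vector `γ_N` of `Υ(N)`. -/
noncomputable def extremeVector (N : ℤ) : Upsilon N := Submodule.Quotient.mk 1

theorem smul_extremeVector (N : ℤ) (a : Fermion) :
    a • extremeVector N = Submodule.Quotient.mk a := by
  rw [extremeVector, ← Submodule.Quotient.mk_smul, smul_eq_mul, mul_one]

theorem exists_smul_extremeVector {N : ℤ} (v : Upsilon N) :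
    ∃ a : Fermion, a • extremeVector N = v := by
  obtain ⟨a, rfl⟩ := Submodule.Quotient.mk_surjective _ v
  exact ⟨a, smul_extremeVector N a⟩

theorem smul_extremeVector_eq_zero {N : ℤ} {a : Fermion} (h : a ∈ ann N) :
    a • extremeVector N = 0 := by
  rw [smul_extremeVector]
  exact (Submodule.Quotient.mk_eq_zero _).2 h

theorem extremeVector_isExtreme (N : ℤ) : IsExtreme N (extremeVector N) where
  x_smul i hi := smul_extremeVector_eq_zero (Submodule.subset_span (Or.inl ⟨i, hi, rfl⟩))
  y_smul i hi := smul_extremeVector_eq_zero (Submodule.subset_span (Or.inr (Or.inl ⟨i, hi, rfl⟩)))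

theorem gen_mul_gen (k l : ℤ ⊕ ℤ) : gen k * gen l = -(gen l * gen k) :=
  eq_neg_of_add_eq_zero_left (ExteriorAlgebra.ι_add_mul_swap _ _)

theorem gen_mul_self (k : ℤ ⊕ ℤ) : gen k * gen k = 0 := ExteriorAlgebra.ι_sq_zero _

/-- Every element can be moved to the left of a generator, at the price of signs. -/
theorem exists_gen_mul (a : Fermion) : ∃ b : Fermion, ∀ k, gen k * a = b * gen k := by
  suffices h : ∃ b : Fermion, ∀ m : (ℤ ⊕ ℤ) →₀ ℂ,
      ExteriorAlgebra.ι ℂ m * a = b * ExteriorAlgebra.ι ℂ m from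
    h.imp fun b hb k => hb _
  induction a using ExteriorAlgebra.induction with
  | algebraMap r => exact ⟨algebraMap ℂ _ r, fun m => (Algebra.commutes r _).symm⟩
  | ι w =>
    refine ⟨-ExteriorAlgebra.ι ℂ w, fun m => ?_⟩
    rw [neg_mul]
    exact eq_neg_of_add_eq_zero_left (ExteriorAlgebra.ι_add_mul_swap _ _)
  | mul a b ha hb =>
    obtain ⟨a', ha⟩ := ha
    obtain ⟨b', hb⟩ := hb
    exact ⟨a' * b', fun m => by rw [← mul_assoc, ha, mul_assoc, hb, mul_assoc]⟩
  | add a b ha hb =>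
    obtain ⟨a', ha⟩ := ha
    obtain ⟨b', hb⟩ := hb
    exact ⟨a' + b', fun m => by rw [mul_add, add_mul, ha, hb]⟩

theorem x_smul_eq_zero {N i : ℤ} (hi : N - 1 ≤ i) (v : Upsilon N) : x i • v = 0 := by
  obtain ⟨a, rfl⟩ := exists_smul_extremeVector v
  obtain ⟨b, hb⟩ := exists_gen_mul a
  rw [← mul_smul, x, hb, mul_smul]
  exact (congrArg (b • ·) ((extremeVector_isExtreme N).x_smul i hi)).trans (smul_zero b)

theorem y_smul_eq_zero {N i : ℤ} (hi : N ≤ i) (v : Upsilon N) : y i • v = 0 := by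
  obtain ⟨a, rfl⟩ := exists_smul_extremeVector v
  obtain ⟨b, hb⟩ := exists_gen_mul a
  rw [← mul_smul, y, hb, mul_smul]
  exact (congrArg (b • ·) ((extremeVector_isExtreme N).y_smul i hi)).trans (smul_zero b)

theorem x_smul_y_smul {V : Type*} [AddCommGroup V] [Module Fermion V] (i j : ℤ) (v : V) :
    x i • y j • v = -(y j • x i • v) := by
  rw [← mul_smul, ← mul_smul, x, y, gen_mul_gen, neg_smul]

/-- The relators annihilate `Υ(N)`, not only the extreme vector. -/
theorem relator_smul_eq_zero (N s : ℤ) (v : Upsilon N) : relator N s • v = 0 := by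
  obtain ⟨a, rfl⟩ := exists_smul_extremeVector v
  obtain ⟨b, hb⟩ := exists_gen_mul a
  obtain ⟨d, hd⟩ := exists_gen_mul b
  have h : relator N s * a = d * relator N s := by
    rw [relator, Finset.sum_mul, Finset.mul_sum]
    refine Finset.sum_congr rfl fun i _ => ?_
    rw [x, y, mul_assoc, hb, ← mul_assoc, hd, mul_assoc]
  rw [← mul_smul, h, mul_smul, smul_extremeVector_eq_zero, smul_zero]
  exact Submodule.subset_span (Or.inr (Or.inr (Or.inl ⟨s, rfl⟩)))

theorem relatorAlt_smul_eq_zero (N s : ℤ) (v : Upsilon N) : relatorAlt N s • v = 0 := by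
  obtain ⟨a, rfl⟩ := exists_smul_extremeVector v
  obtain ⟨b, hb⟩ := exists_gen_mul a
  obtain ⟨d, hd⟩ := exists_gen_mul b
  have h : relatorAlt N s * a = d * relatorAlt N s := by
    rw [relatorAlt, Finset.sum_mul, Finset.mul_sum]
    refine Finset.sum_congr rfl fun i _ => ?_
    rw [smul_mul_assoc, mul_smul_comm, x, y, mul_assoc, hb, ← mul_assoc, hd, mul_assoc]
  rw [← mul_smul, h, mul_smul, smul_extremeVector_eq_zero, smul_zero]
  exact Submodule.subset_span (Or.inr (Or.inr (Or.inr ⟨s, rfl⟩)))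

/-- Where all `xᵢ`, `i ≥ N - 1`, and all `yᵢ`, `i ≥ N`, annihilate `v`, the infinite sums of `REL`
are the action of the relators. -/
theorem finsum_eq_relator_smul {V : Type*} [AddCommGroup V] [Module Fermion V]
    {N : ℤ} {v : V} (hv : IsExtreme N v) (s : ℤ) :
    ∑ᶠ i : ℤ, x i • y (-i + s) • v = relator N s • v := by
  rw [finsum_eq_sum_of_support_subset (s := Finset.Icc (s - N + 1) (N - 2)), relator,
    Finset.sum_smul]
  · simp only [mul_smul]
  · intro i hi
    rw [Function.mem_support] at hi
    by_contra h
    apply hi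
    rw [Finset.coe_Icc, Set.mem_Icc, not_and_or, not_le, not_le] at h
    rcases h with h | h
    · rw [hv.y_smul _ (by omega), smul_zero]
    · rw [x_smul_y_smul, hv.x_smul _ (by omega), smul_zero, neg_zero]

theorem finsum_eq_relatorAlt_smul {V : Type*} [AddCommGroup V] [Module ℂ V] [Module Fermion V]
    [IsScalarTower ℂ Fermion V] {N : ℤ} {v : V} (hv : IsExtreme N v) (s : ℤ) :
    ∑ᶠ i : ℤ, ((-1 : ℂ) ^ i) • x i • y (-i + 2 * s + 1) • v = relatorAlt N s • v := by
  rw [finsum_eq_sum_of_support_subset (s := Finset.Icc (2 * s + 1 - N + 1) (N - 2)), relatorAlt,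
    Finset.sum_smul]
  · simp only [mul_smul, smul_assoc]
  · intro i hi
    rw [Function.mem_support] at hi
    by_contra h
    apply hi
    rw [Finset.coe_Icc, Set.mem_Icc, not_and_or, not_le, not_le] at h
    rcases h with h | h
    · rw [hv.y_smul _ (by omega), smul_zero, smul_zero]
    · rw [x_smul_y_smul, hv.x_smul _ (by omega), smul_zero, neg_zero, smul_zero]

/-- The relations `REL` hold in `Υ(N)`. -/
theorem Upsilon.satisfiesREL (N : ℤ) : SatisfiesREL (Upsilon N) where
  smooth v := ⟨N, fun i hi => ⟨x_smul_eq_zero (by omega) v, y_smul_eq_zero hi v⟩⟩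
  rel s v := by
    rw [finsum_eq_relator_smul (N := N)
      ⟨fun i hi => x_smul_eq_zero hi v, fun i hi => y_smul_eq_zero hi v⟩, relator_smul_eq_zero]
  rel_alt s v := by
    rw [finsum_eq_relatorAlt_smul (N := N)
      ⟨fun i hi => x_smul_eq_zero hi v, fun i hi => y_smul_eq_zero hi v⟩, relatorAlt_smul_eq_zero]

/-- The homomorphism from `Υ(N)` that sends `γ_N` to a given extreme vector of level `N`. -/
noncomputable def lift {V : Type*} [AddCommGroup V] [Module ℂ V] [Module Fermion V]
    [IsScalarTower ℂ Fermion V] (hV : SatisfiesREL V) {N : ℤ} {v : V} (hv : IsExtreme N v) :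
    Upsilon N →ₗ[Fermion] V :=
  (ann N).liftQ (LinearMap.toSpanSingleton Fermion V v) <| by
    refine Submodule.span_le.2 ?_
    rintro a (⟨i, hi, rfl⟩ | ⟨i, hi, rfl⟩ | ⟨s, rfl⟩ | ⟨s, rfl⟩)
    · exact hv.x_smul i hi
    · exact hv.y_smul i hi
    · exact (finsum_eq_relator_smul hv s).symm.trans (hV.rel s v)
    · exact (finsum_eq_relatorAlt_smul hv s).symm.trans (hV.rel_alt s v)

theorem lift_extremeVector {V : Type*} [AddCommGroup V] [Module ℂ V] [Module Fermion V]
    [IsScalarTower ℂ Fermion V] (hV : SatisfiesREL V) {N : ℤ} {v : V} (hv : IsExtreme N v) :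
    lift hV hv (extremeVector N) = v :=
  one_smul Fermion v

/-- `Υ(N)` is induced from its extreme vector: it is universal among the representations with an
extreme vector of level `N`. -/
theorem Upsilon.existsUnique_lift {V : Type*} [AddCommGroup V] [Module ℂ V] [Module Fermion V]
    [IsScalarTower ℂ Fermion V] (hV : SatisfiesREL V) {N : ℤ} {v : V} (hv : IsExtreme N v) :
    ∃! f : Upsilon N →ₗ[Fermion] V, f (extremeVector N) = v := by
  refine ⟨lift hV hv, lift_extremeVector hV hv, fun f hf => LinearMap.ext fun w => ?_⟩
  obtain ⟨a, rfl⟩ := exists_smul_extremeVector w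
  rw [map_smul, map_smul, hf, lift_extremeVector]

/-- The algebra homomorphism `a ↦ a + ε δ(a)` for the derivation `δ` below. -/
noncomputable def derivHom (w : ℤ ⊕ ℤ → ℂ) : Fermion →ₐ[ℂ] TrivSqZeroExt Fermion Fermion :=
  ExteriorAlgebra.lift ℂ
    ⟨TrivSqZeroExt.inlAlgHom ℂ Fermion Fermion ∘ₗ ExteriorAlgebra.ι ℂ +
      (TrivSqZeroExt.inrHom Fermion Fermion).restrictScalars ℂ ∘ₗ ExteriorAlgebra.ι ℂ ∘ₗ
        Finsupp.linearCombination ℂ (fun k => w k • Finsupp.single k (1 : ℂ)), fun m => by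
      refine TrivSqZeroExt.ext ?_ ?_
      · simp
      · simp [ExteriorAlgebra.ι_add_mul_swap]⟩

/-- The derivation of the algebra of anticommuting variables that multiplies the generator with
index `k` by `w k`. -/
noncomputable def deriv (w : ℤ ⊕ ℤ → ℂ) : Fermion →ₗ[ℂ] Fermion :=
  (TrivSqZeroExt.sndHom Fermion Fermion).restrictScalars ℂ ∘ₗ (derivHom w).toLinearMap

theorem fst_derivHom (w : ℤ ⊕ ℤ → ℂ) (a : Fermion) : (derivHom w a).fst = a := by
  have h : (TrivSqZeroExt.fstHom ℂ Fermion Fermion).comp (derivHom w) = AlgHom.id ℂ Fermion := by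
    ext m
    simp [derivHom]
  exact DFunLike.congr_fun h a

theorem deriv_mul (w : ℤ ⊕ ℤ → ℂ) (a b : Fermion) :
    deriv w (a * b) = a * deriv w b + deriv w a * b := by
  simp [deriv, fst_derivHom]

theorem deriv_one (w : ℤ ⊕ ℤ → ℂ) : deriv w 1 = 0 := by
  simp [deriv]

theorem deriv_gen (w : ℤ ⊕ ℤ → ℂ) (k : ℤ ⊕ ℤ) : deriv w (gen k) = w k • gen k := by
  simp [deriv, derivHom, gen, ← map_smul]

theorem deriv_comm (w w' : ℤ ⊕ ℤ → ℂ) (a : Fermion) :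
    deriv w (deriv w' a) = deriv w' (deriv w a) := by
  induction a using ExteriorAlgebra.induction with
  | algebraMap r => simp [Algebra.algebraMap_eq_smul_one, deriv_one]
  | ι m =>
    induction m using Finsupp.induction_linear with
    | zero => simp
    | add f g hf hg => simp only [map_add, hf, hg]
    | single k r =>
      have h : ExteriorAlgebra.ι ℂ (Finsupp.single k r) = r • gen k := by
        rw [gen, ← map_smul, Finsupp.smul_single_one]
      simp only [h, map_smul, deriv_gen, smul_comm (w k) (w' k)]
  | mul a b ha hb =>
    simp only [deriv_mul, map_add, ha, hb]
    abel
  | add a b ha hb => simp only [map_add, ha, hb]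

/-- The grading by charge: `xᵢ` and `yᵢ` have charge `1`. -/
def chargeWeight : ℤ ⊕ ℤ → ℂ := fun _ => 1

/-- The grading by energy: `xᵢ` and `yᵢ` have energy `-i`. -/
def energyWeight : ℤ ⊕ ℤ → ℂ := Sum.elim (fun i => -(i : ℂ)) (fun i => -(i : ℂ))

theorem deriv_mem_ann {w : ℤ ⊕ ℤ → ℂ} (hw : w = chargeWeight ∨ w = energyWeight) {N : ℤ}
    {a : Fermion} (ha : a ∈ ann N) : deriv w a ∈ ann N := by
  have hx : ∀ i, deriv w (x i) = w (Sum.inl i) • x i := fun i => deriv_gen w _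
  have hy : ∀ i, deriv w (y i) = w (Sum.inr i) • y i := fun i => deriv_gen w _
  have hxy : ∃ d : ℤ → ℂ, ∀ i j, deriv w (x i * y j) = d (i + j) • (x i * y j) := by
    rcases hw with rfl | rfl
    · refine ⟨fun _ => 2, fun i j => ?_⟩
      rw [deriv_mul, hx, hy, smul_mul_assoc, mul_smul_comm, ← add_smul]
      congr 1
      norm_num [chargeWeight]
    · refine ⟨fun s => -(s : ℂ), fun i j => ?_⟩
      rw [deriv_mul, hx, hy, smul_mul_assoc, mul_smul_comm, ← add_smul]
      congr 1
      simp [energyWeight]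
  obtain ⟨d, hd⟩ := hxy
  have key : ∀ g ∈ annSet N, ∃ r : ℂ, deriv w g = r • g := by
    rintro g (⟨i, hi, rfl⟩ | ⟨i, hi, rfl⟩ | ⟨s, rfl⟩ | ⟨s, rfl⟩)
    · exact ⟨_, hx i⟩
    · exact ⟨_, hy i⟩
    · refine ⟨d s, ?_⟩
      rw [relator, map_sum, Finset.smul_sum]
      refine Finset.sum_congr rfl fun i _ => ?_
      rw [hd, show i + (-i + s) = s by ring]
    · refine ⟨d (2 * s + 1), ?_⟩
      rw [relatorAlt, map_sum, Finset.smul_sum]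
      refine Finset.sum_congr rfl fun i _ => ?_
      rw [map_smul, hd, show i + (-i + 2 * s + 1) = 2 * s + 1 by ring, smul_comm]
  refine Submodule.span_induction (p := fun a _ => deriv w a ∈ ann N) ?_ ?_ ?_ ?_ ha
  · intro g hg
    obtain ⟨r, hr⟩ := key g hg
    rw [hr]
    exact (ann N).smul_of_tower_mem r (Submodule.subset_span hg)
  · rw [map_zero]
    exact zero_mem _
  · intro a b _ _ ha hb
    rw [map_add]
    exact add_mem ha hb
  · intro a b hb hb'
    rw [smul_eq_mul, deriv_mul]
    exact add_mem ((ann N).smul_mem a hb') ((ann N).smul_mem (deriv w a) hb)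

/-- The operator on `Υ(N)` that multiplies `a ∘ γ_N`, for a product `a` of generators, by `r` plus
the sum of the weights of the factors; here `w` is the charge or the energy. -/
noncomputable def gradingOp (N : ℤ) (w : ℤ ⊕ ℤ → ℂ) (hw : w = chargeWeight ∨ w = energyWeight)
    (r : ℂ) : Module.End ℂ (Upsilon N) :=
  ((ann N).restrictScalars ℂ).mapQ ((ann N).restrictScalars ℂ) (deriv w)
    (fun _ ha => deriv_mem_ann hw ha) + r • LinearMap.id

/-- The operator `c` on `Υ(N)` with `c ∘ γ_N = r γ_N`. -/
noncomputable def Upsilon.c (N : ℤ) (r : ℂ) : Module.End ℂ (Upsilon N) :=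
  gradingOp N chargeWeight (Or.inl rfl) r

/-- The operator `u` on `Υ(N)` with `u ∘ γ_N = r γ_N`. -/
noncomputable def Upsilon.u (N : ℤ) (r : ℂ) : Module.End ℂ (Upsilon N) :=
  gradingOp N energyWeight (Or.inr rfl) r

theorem gradingOp_smul (N : ℤ) (w : ℤ ⊕ ℤ → ℂ) (hw : w = chargeWeight ∨ w = energyWeight)
    (r : ℂ) (a : Fermion) :
    gradingOp N w hw r (a • extremeVector N) = (deriv w a + r • a) • extremeVector N := by
  simp only [smul_extremeVector]
  rfl

theorem gradingOp_extremeVector (N : ℤ) (w : ℤ ⊕ ℤ → ℂ)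
    (hw : w = chargeWeight ∨ w = energyWeight) (r : ℂ) :
    gradingOp N w hw r (extremeVector N) = r • extremeVector N := by
  have h := gradingOp_smul N w hw r 1
  rwa [deriv_one, zero_add, one_smul, smul_assoc, one_smul] at h

theorem gradingOp_gen_smul (N : ℤ) (w : ℤ ⊕ ℤ → ℂ) (hw : w = chargeWeight ∨ w = energyWeight)
    (r : ℂ) (k : ℤ ⊕ ℤ) (v : Upsilon N) :
    gradingOp N w hw r (gen k • v) - gen k • gradingOp N w hw r v = w k • gen k • v := by
  obtain ⟨a, rfl⟩ := exists_smul_extremeVector v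
  rw [← mul_smul, gradingOp_smul, gradingOp_smul, ← mul_smul, ← sub_smul, ← smul_assoc, deriv_mul,
    deriv_gen]
  congr 1
  rw [mul_add, mul_smul_comm, smul_mul_assoc]
  abel

/-- `Υ(N)` is a representation of the **SqL** algebra, whatever the eigenvalues of `c` and `u` on
the extreme vector. -/
theorem Upsilon.isSqLRep (N : ℤ) (r r' : ℂ) :
    IsSqLRep (Upsilon N) (Upsilon.c N r) (Upsilon.u N r') where
  toSatisfiesREL := Upsilon.satisfiesREL N
  c_u v := by
    obtain ⟨a, rfl⟩ := exists_smul_extremeVector v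
    rw [Upsilon.c, Upsilon.u, gradingOp_smul, gradingOp_smul, gradingOp_smul, gradingOp_smul,
      ← sub_smul]
    simp only [map_add, map_smul, smul_add, deriv_comm chargeWeight energyWeight,
      smul_comm r r' a]
    rw [← zero_smul Fermion (extremeVector N)]
    congr 1
    abel
  c_x i v := (gradingOp_gen_smul N _ _ r _ v).trans (one_smul ℂ (x i • v))
  c_y i v := (gradingOp_gen_smul N _ _ r _ v).trans (one_smul ℂ (y i • v))
  u_x i v := gradingOp_gen_smul N _ _ r' _ v
  u_y i v := gradingOp_gen_smul N _ _ r' _ v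

/-- In `Υ(N + 1)`, the vector `y_N ∘ γ_{N+1}` is an extreme vector of level `N`. -/
theorem y_smul_extremeVector_isExtreme (N : ℤ) :
    IsExtreme N (y N • extremeVector (N + 1)) where
  x_smul i hi := by
    rcases eq_or_lt_of_le hi with rfl | hi
    · have h := relator_smul_eq_zero (N + 1) (2 * N - 1) (extremeVector (N + 1))
      rw [relator, show 2 * N - 1 - (N + 1) + 1 = N - 1 by ring, show N + 1 - 2 = N - 1 by ring,
        Finset.Icc_self, Finset.sum_singleton, show -(N - 1) + (2 * N - 1) = N by ring,
        mul_smul] at h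
      exact h
    · rw [x_smul_y_smul, x_smul_eq_zero (by omega), smul_zero, neg_zero]
  y_smul i hi := by
    rcases eq_or_lt_of_le hi with rfl | hi
    · rw [← mul_smul, y, gen_mul_self, zero_smul]
    · exact y_smul_eq_zero (by omega) _

/-- The map `Υ(N) ⟶ Υ(N + 1)` with `γ_N ↦ y_N ∘ γ_{N+1}`. -/
noncomputable def transition (N : ℤ) : Upsilon N →ₗ[Fermion] Upsilon (N + 1) :=
  lift (Upsilon.satisfiesREL (N + 1)) (y_smul_extremeVector_isExtreme N)

theorem transition_extremeVector (N : ℤ) :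
    transition N (extremeVector N) = y N • extremeVector (N + 1) :=
  lift_extremeVector _ _

/-- The monomial `x_{i₁} ⋯ x_{iₗ} y_{j₁} ⋯ y_{jₘ}` with `{i₁ < ⋯ < iₗ} = I` and
`{j₁ < ⋯ < jₘ} = J`. -/
noncomputable def monomial (I J : Finset ℤ) : Fermion :=
  ((I.sort (· ≤ ·)).map x).prod * ((J.sort (· ≤ ·)).map y).prod

/-- The index sets of the basis monomials of `Υ(N)`: no factor annihilates `γ_N`, and the indices
of an `x` and of a `y` differ by at least `2`. -/
structure IsConfiguration (N : ℤ) (I J : Finset ℤ) : Prop where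
  lt_x : ∀ i ∈ I, i < N - 1
  lt_y : ∀ j ∈ J, j < N
  two_le : ∀ i ∈ I, ∀ j ∈ J, 2 ≤ |i - j|

end SqL

/-! Both halves of (a) rest on one statistic of a monomial, the sum of the squares of its indices.

Spanning: if `|i - j| < 2`, then `x i * y j` has the smallest sum of squares among the terms of its
energy that occur in a suitable relation. For `i = j` the plain relation serves; for `|i - j| = 1`
the plain and the alternating relation combine into one over the first indices of the parity of `i`,
which excludes the competitor `x j * y i`. Solving for `x i * y j` (`exists_rewrite`) raises the sum
of squares. At fixed energy and number of factors that sum is bounded, as the indices of factors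
that do not act as zero are bounded above, so the rewriting ends at configurations
(`prod_smul_mem_configurationSpan`).

Independence: let `ψ_p` be free fermions and `X_t` commuting variables, and send `x_i` to the sum of
`X_t ψ_{i+t}` over even `t ≥ 0`, and `y_i` to the same sum over odd `t ≥ -1`. In the image of a
relation the coefficient of `ψ_p ψ_q` is symmetric in `p` and `q`, so the image vanishes
(`realization_relation`). Keeping only finitely many `ψ_p` with `p ≤ N - 2` makes everything finite
and also kills the generators that annihilate `γ_N`. In the image of a configuration one term is
singled out: going from right to left, each factor gets the least shift that is at least the
previous one (`exists_shift`). The gap of 2 between an `x` and a `y` leaves room for the change of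
parity, so the fermion indices stay distinct. By the rearrangement inequality, any other
configuration whose image contains this term has a smaller sum of squares (`sum_sq_lt_or_eq`). The
resulting functionals are triangular on the configurations.

For (b), the map appends `N` to the `y`-indices of a configuration, hence carries a basis
injectively into a basis. -/

namespace SqL

/-! ### The free-field realization and the relations -/

/-- The coefficient ring of the free-field realization: polynomials in commuting variables that
are indexed by the possible shifts. -/
abbrev Coeff : Type := MvPolynomial ℤ ℂ

/-- The index of a generator. -/
def pos : ℤ ⊕ ℤ → ℤ := Sum.elim id id

/-- The shifts that occur in the free-field realization of a generator: the nonnegative even ones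
for `xᵢ`, the odd ones from `-1` on for `yᵢ`. -/
def IsShift : ℤ ⊕ ℤ → ℤ → Prop :=
  Sum.elim (fun _ t => Even t ∧ 0 ≤ t) (fun _ t => Odd t ∧ -1 ≤ t)

open Classical in
/-- The coefficient with which a shift occurs in the free-field realization of a generator. -/
noncomputable def amplitude (k : ℤ ⊕ ℤ) (t : ℤ) : Coeff :=
  if IsShift k t then MvPolynomial.X t else 0

theorem amplitude_eq_zero {k : ℤ ⊕ ℤ} {t : ℤ} (h : ¬IsShift k t) : amplitude k t = 0 := if_neg h

/-- The coordinates of the free-field realization of a generator with respect to finitely many free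
fermions, the `r`-th of them having index `s r`. -/
noncomputable def coord {n : ℕ} (s : Fin n → ℤ) (k : ℤ ⊕ ℤ) (r : Fin n) : Coeff :=
  amplitude k (s r - pos k)

/-- The free-field realization of the anticommuting variables. -/
noncomputable def realization {n : ℕ} (s : Fin n → ℤ) :
    Fermion →ₐ[ℂ] ExteriorAlgebra Coeff (Fin n → Coeff) :=
  ExteriorAlgebra.lift ℂ
    ⟨(ExteriorAlgebra.ι Coeff).restrictScalars ℂ ∘ₗ Finsupp.linearCombination ℂ (coord s),
      fun _ => ExteriorAlgebra.ι_sq_zero _⟩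

theorem realization_gen {n : ℕ} (s : Fin n → ℤ) (k : ℤ ⊕ ℤ) :
    realization s (gen k) = ExteriorAlgebra.ι Coeff (coord s k) := by
  refine (ExteriorAlgebra.lift_ι_apply ℂ _ _ _).trans ?_
  rw [LinearMap.comp_apply, Finsupp.linearCombination_single, one_smul]
  rfl

theorem ι_eq_sum {n : ℕ} (v : Fin n → Coeff) :
    ExteriorAlgebra.ι Coeff v =
      ∑ r, v r • ExteriorAlgebra.ι Coeff (Pi.single r (1 : Coeff) : Fin n → Coeff) := by
  conv_lhs => rw [pi_eq_sum_univ' v]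
  rw [map_sum]
  simp only [map_smul]

/-- A quadratic expression in anticommuting elements with symmetric coefficients vanishes. -/
theorem sum_symm_smul_eq_zero {n : ℕ} (C : Fin n → Fin n → Coeff) (hC : ∀ r r', C r r' = C r' r) :
    ∑ r, ∑ r', C r r' • (ExteriorAlgebra.ι Coeff (Pi.single r (1 : Coeff) : Fin n → Coeff) *
      ExteriorAlgebra.ι Coeff (Pi.single r' (1 : Coeff) : Fin n → Coeff)) = 0 := by
  set S := ∑ r, ∑ r', C r r' • (ExteriorAlgebra.ι Coeff (Pi.single r (1 : Coeff) : Fin n → Coeff) *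
      ExteriorAlgebra.ι Coeff (Pi.single r' (1 : Coeff) : Fin n → Coeff)) with hS
  have h : S = -S := by
    conv_lhs => rw [hS, Finset.sum_comm]
    rw [hS, ← Finset.sum_neg_distrib]
    refine Finset.sum_congr rfl fun r _ => ?_
    rw [← Finset.sum_neg_distrib]
    refine Finset.sum_congr rfl fun r' _ => ?_
    rw [hC r' r, eq_neg_of_add_eq_zero_left (ExteriorAlgebra.ι_add_mul_swap
      (Pi.single r' (1 : Coeff) : Fin n → Coeff) (Pi.single r (1 : Coeff) : Fin n → Coeff)), smul_neg]
  have h2 : (2 : ℂ) • S = 0 := by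
    rw [two_smul]
    nth_rewrite 1 [h]
    exact neg_add_cancel S
  exact (smul_eq_zero_iff_right two_ne_zero).1 h2

/-- Exchanging the two fermions amounts to translating the summation index, which leaves both shifts
unchanged; the coefficients are therefore symmetric. The weight `g` treats both kinds of relation at
once: it is 1 or, for odd `t`, the alternating sign, which only even translations preserve. -/
theorem realization_relation {n : ℕ} {s : Fin n → ℤ} {N : ℤ} (hs : ∀ r, s r ≤ N - 2) (t : ℤ)
    (g : ℤ → ℂ) (hg : ∀ i d, (Odd t → Even d) → g (i + d) = g i) :
    realization s (∑ i ∈ Finset.Icc (t - N + 1) (N - 2), g i • (x i * y (-i + t))) = 0 := by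
  let f : Fin n → Fin n → ℤ → Coeff := fun r r' i =>
    g i • (coord s (Sum.inl i) r * coord s (Sum.inr (-i + t)) r')
  have hf : ∀ r r' i, f r r' i ≠ 0 → (Even (s r - i) ∧ 0 ≤ s r - i) ∧
      (Odd (s r' - (-i + t)) ∧ -1 ≤ s r' - (-i + t)) := by
    intro r r' i h
    constructor
    · by_contra h'
      exact h (by rw [show f r r' i = g i • (coord s (Sum.inl i) r * _) from rfl, coord,
        show amplitude (Sum.inl i) (s r - pos (Sum.inl i)) = 0 from amplitude_eq_zero h',
        zero_mul, smul_zero])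
    · by_contra h'
      exact h (by rw [show f r r' i = g i • (_ * amplitude _ (s r' - pos (Sum.inr (-i + t)))) from rfl,
        show amplitude (Sum.inr (-i + t)) (s r' - pos (Sum.inr (-i + t))) = 0 from amplitude_eq_zero h',
        mul_zero, smul_zero])
  -- The shift bounds 0 and -1, with fermion indices at most `N - 2`, confine the support to exactly
  -- the range of the relator. The full sum over `ℤ` can then be translated freely.
  have hsum : ∀ r r', ∑ i ∈ Finset.Icc (t - N + 1) (N - 2), f r r' i = ∑ᶠ i, f r r' i := by
    intro r r'
    refine (finsum_eq_sum_of_support_subset _ fun i hi => ?_).symm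
    obtain ⟨⟨-, h1⟩, -, h2⟩ := hf r r' i hi
    have := hs r
    have := hs r'
    rw [Finset.coe_Icc, Set.mem_Icc]
    omega
  have hshift : ∀ r r' i, f r r' i ≠ 0 → f r r' i = f r' r (i + (s r' - s r)) := by
    intro r r' i h
    obtain ⟨⟨h1, -⟩, h2, -⟩ := hf r r' i h
    -- The two shifts have opposite parities and add up to `s r + s r' - t`.
    have hd : Odd t → Even (s r' - s r) := fun ht => by
      have h3 := ((h2.add_odd ht).sub h1).sub (even_two_mul i)
      rwa [show s r' - (-i + t) + t - (s r - i) - 2 * i = s r' - s r by ring] at h3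
    change _ = g (i + (s r' - s r)) • (amplitude (Sum.inl i) (s r' - (i + (s r' - s r))) *
      amplitude (Sum.inr (-i + t)) (s r - (-(i + (s r' - s r)) + t)))
    rw [hg i _ hd, show s r' - (i + (s r' - s r)) = s r - i by ring,
      show s r - (-(i + (s r' - s r)) + t) = s r' - (-i + t) by ring]
    rfl
  have hsymm : ∀ r r', ∑ᶠ i, f r r' i = ∑ᶠ i, f r' r i := by
    intro r r'
    rw [← finsum_comp_equiv (Equiv.addRight (s r' - s r)) (f := f r' r)]
    refine finsum_congr fun i => ?_
    -- The translation is only known to preserve nonzero terms, so a zero term needs the inverse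
    -- translation.
    by_cases h : f r r' i = 0
    · by_contra h'
      rw [h] at h'
      have h'' := hshift r' r (i + (s r' - s r)) (Ne.symm h')
      rw [show i + (s r' - s r) + (s r - s r') = i by ring, h] at h''
      exact h' h''.symm
    · exact hshift r r' i h
  rw [map_sum]
  calc _ = ∑ i ∈ Finset.Icc (t - N + 1) (N - 2), ∑ r, ∑ r', f r r' i •
        (ExteriorAlgebra.ι Coeff (Pi.single r (1 : Coeff) : Fin n → Coeff) *
          ExteriorAlgebra.ι Coeff (Pi.single r' (1 : Coeff) : Fin n → Coeff)) := by
        refine Finset.sum_congr rfl fun i _ => ?_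
        rw [map_smul, map_mul, x, y, realization_gen, realization_gen, ι_eq_sum, ι_eq_sum (coord s (Sum.inr _)),
          Finset.sum_mul, Finset.smul_sum]
        refine Finset.sum_congr rfl fun r _ => ?_
        rw [Finset.mul_sum, Finset.smul_sum]
        refine Finset.sum_congr rfl fun r' _ => ?_
        rw [smul_mul_smul_comm, smul_assoc]
    _ = ∑ r, ∑ r', (∑ᶠ i, f r r' i) •
        (ExteriorAlgebra.ι Coeff (Pi.single r (1 : Coeff) : Fin n → Coeff) *
          ExteriorAlgebra.ι Coeff (Pi.single r' (1 : Coeff) : Fin n → Coeff)) := by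
        rw [Finset.sum_comm]
        refine Finset.sum_congr rfl fun r _ => ?_
        rw [Finset.sum_comm]
        refine Finset.sum_congr rfl fun r' _ => ?_
        rw [← Finset.sum_smul, hsum]
    _ = 0 := sum_symm_smul_eq_zero _ hsymm

/-- The free-field realization factors through `Υ(N)`. -/
theorem realization_eq_zero {n : ℕ} {s : Fin n → ℤ} {N : ℤ} (hs : ∀ r, s r ≤ N - 2) {a : Fermion}
    (ha : a ∈ ann N) : realization s a = 0 := by
  suffices h : ann N ≤ RingHom.ker (realization s) from h ha
  refine Submodule.span_le.2 ?_
  have hzero : ∀ k, (∀ r, ¬IsShift k (s r - pos k)) → realization s (gen k) = 0 := by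
    intro k hk
    have h : coord s k = 0 := funext fun r => amplitude_eq_zero (hk r)
    rw [realization_gen, h, map_zero]
  rintro a (⟨i, hi, rfl⟩ | ⟨i, hi, rfl⟩ | ⟨t, rfl⟩ | ⟨t, rfl⟩)
  -- Reaching an index at most `N - 2` would take a negative shift for this `x`, and in the next
  -- case a shift below -1 for `y`.
  · refine hzero _ fun r h => ?_
    have := hs r
    have : 0 ≤ s r - i := h.2
    omega
  · refine hzero _ fun r h => ?_
    have := hs r
    have h1 : Odd (s r - i) := h.1
    have : -1 ≤ s r - i := h.2
    omega
  · have h := realization_relation hs t (fun _ => 1) fun _ _ _ => rfl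
    simp only [one_smul] at h
    exact h
  · have h := realization_relation hs (2 * t + 1) (fun i => (-1) ^ i) fun i d hd => by
      rw [zpow_add₀ (by norm_num), (hd ⟨t, rfl⟩).neg_one_zpow, mul_one]
    simp only [← add_assoc] at h
    exact h

/-! ### The leading term of a configuration -/

/-- Shifts that make the indices of the free fermions in the leading term of a basis monomial
as close to each other as possible. The finite set `U` holds the indices of the factors, and `k u`
is the factor with index `u`. -/
theorem exists_shift (N : ℤ) (k : ℤ → ℤ ⊕ ℤ) (U : Finset ℤ)
    (hU : ∀ u ∈ U, ∀ t, IsShift (k u) t → t ≤ 0 → u + t ≤ N - 2)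
    (hk : ∀ u ∈ U, ∀ v ∈ U, (k u).isLeft ≠ (k v).isLeft → 2 ≤ |u - v|) :
    ∃ τ : ℤ → ℤ, ∀ u ∈ U, IsShift (k u) (τ u) ∧ u + τ u ≤ N - 2 ∧
      ∀ v ∈ U, u < v → τ v ≤ τ u ∧ u + τ u < v + τ v := by
  induction U using Finset.induction_on_min with
  | empty => exact ⟨0, by simp⟩
  | insert a U ha ih =>
    obtain ⟨τ, hτ⟩ := ih (fun u hu => hU u (Finset.mem_insert_of_mem hu)) fun u hu v hv =>
      hk u (Finset.mem_insert_of_mem hu) v (Finset.mem_insert_of_mem hv)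
    have haU : a ∉ U := fun h => lt_irrefl _ (ha a h)
    suffices h : ∃ t, IsShift (k a) t ∧ a + t ≤ N - 2 ∧
        ∀ v ∈ U, τ v ≤ t ∧ a + t < v + τ v by
      obtain ⟨t, ht, htN, htv⟩ := h
      have hne : ∀ v ∈ U, Function.update τ a t v = τ v := fun v hv =>
        Function.update_of_ne (ne_of_mem_of_not_mem hv haU) _ _
      refine ⟨Function.update τ a t, fun u hu => ?_⟩
      rcases Finset.mem_insert.1 hu with rfl | hu'
      · rw [Function.update_self]
        refine ⟨ht, htN, fun v hv huv => ?_⟩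
        rcases Finset.mem_insert.1 hv with rfl | hv
        · exact absurd huv (lt_irrefl _)
        · rw [hne v hv]
          exact htv v hv
      · rw [hne u hu']
        refine ⟨(hτ u hu').1, (hτ u hu').2.1, fun v hv huv => ?_⟩
        rcases Finset.mem_insert.1 hv with rfl | hv
        · exact absurd huv (ha u hu').not_gt
        · rw [hne v hv]
          exact (hτ u hu').2.2 v hv huv
    have haI := Finset.mem_insert_self a U
    rcases U.eq_empty_or_nonempty with rfl | hne
    -- The rightmost factor gets the smallest shift available: 0 for an `x`, -1 for a `y`.
    · have h : ∃ t, IsShift (k a) t ∧ t ≤ 0 := by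
        rcases k a with i | j
        · exact ⟨0, ⟨Even.zero, le_rfl⟩, le_rfl⟩
        · exact ⟨-1, ⟨⟨-1, rfl⟩, le_rfl⟩, by norm_num⟩
      obtain ⟨t, ht, ht0⟩ := h
      exact ⟨t, ht, hU a haI t ht ht0, by simp⟩
    · obtain ⟨b, hb⟩ : ∃ b, b = U.min' hne := ⟨_, rfl⟩
      have hbU : b ∈ U := hb ▸ U.min'_mem hne
      have hab := ha b hbU
      obtain ⟨hb1, hb2, hb3⟩ := hτ b hbU
      have key : ∀ t, τ b ≤ t → a + t < b + τ b → ∀ v ∈ U, τ v ≤ t ∧ a + t < v + τ v := by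
        intro t h1 h2 v hv
        rcases (hb ▸ U.min'_le v hv : b ≤ v).eq_or_lt with rfl | h
        · exact ⟨h1, h2⟩
        · have := hb3 v hv h
          omega
      have hsw : (k a).isLeft ≠ (k b).isLeft → a + 2 ≤ b := fun h => by
        have := hk a haI b (Finset.mem_insert_of_mem hbU) h
        rw [abs_of_neg (by omega)] at this
        omega
      -- A factor of the same kind as its right neighbour copies the shift. Otherwise the shift
      -- grows by 1 to change parity, and the gap of 2 keeps the fermion indices strictly
      -- increasing.
      have h : ∃ t, IsShift (k a) t ∧ τ b ≤ t ∧ a + t < b + τ b := by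
        rcases hka : k a with i | i <;> rcases hkb : k b with j | j <;>
          rw [hka, hkb] at hsw <;> rw [hkb] at hb1
        · exact ⟨τ b, hb1, le_rfl, by omega⟩
        · have := hsw (by simp)
          exact ⟨τ b + 1, ⟨hb1.1.add_one, by have : -1 ≤ τ b := hb1.2; omega⟩, by omega, by omega⟩
        · have := hsw (by simp)
          exact ⟨τ b + 1, ⟨hb1.1.add_one, by have : 0 ≤ τ b := hb1.2; omega⟩, by omega, by omega⟩
        · exact ⟨τ b, hb1, le_rfl, by omega⟩
      obtain ⟨t, h1, h2, h3⟩ := h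
      exact ⟨t, h1, by omega, key t h2 h3⟩

/-! ### Leading coefficients and the rearrangement inequality -/

/-- Two families with the same multiset of values differ by a permutation. -/
theorem exists_perm_of_sum_single {n : ℕ} {a τ : Fin n → ℤ}
    (h : ∑ r, Finsupp.single (a r) 1 = ∑ r, Finsupp.single (τ r) (1 : ℕ)) :
    ∃ π : Equiv.Perm (Fin n), a = τ ∘ π := by
  have h1 : (List.ofFn a).Perm (List.ofFn τ) := by
    have h2 := congrArg Finsupp.toMultiset h
    have h3 : ∀ f : Fin n → ℤ, Finsupp.toMultiset (∑ r, Finsupp.single (f r) 1) = List.ofFn f := by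
      intro f
      rw [← Fin.univ_val_map, ← Multiset.sum_map_singleton (Finset.univ.val.map f),
        Multiset.map_map, map_sum, Finset.sum_eq_multiset_sum]
      simp only [Finsupp.toMultiset_single, one_smul, Function.comp_def]
    rwa [h3, h3, Multiset.coe_eq_coe] at h2
  have h2 : a ∘ Tuple.sort a = τ ∘ Tuple.sort τ :=
    List.ofFn_injective <|
      (((Tuple.sort a).ofFn_comp_perm a).trans (h1.trans ((Tuple.sort τ).ofFn_comp_perm τ).symm)).eq_of_pairwise'
        (Tuple.monotone_sort a).sortedLE_ofFn.pairwise (Tuple.monotone_sort τ).sortedLE_ofFn.pairwise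
  refine ⟨(Tuple.sort a).symm.trans (Tuple.sort τ), funext fun r => ?_⟩
  simpa using congrFun h2 ((Tuple.sort a).symm r)

/-- The coefficient of the product of the variables with indices `τ r` in the coefficient of the
product of the free fermions with indices `s r`, in the free-field realization. -/
noncomputable def leadingCoeff {n : ℕ} (s τ : Fin n → ℤ) : Fermion →ₗ[ℂ] ℂ :=
  MvPolynomial.lcoeff ℂ (∑ r, Finsupp.single (τ r) 1) ∘ₗ
    -- The determinant in degree `n`, and zero in all other degrees, reads off the coefficient of
    -- the product of all `n` fermions.
    (ExteriorAlgebra.liftAlternating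
      (Pi.single (M := fun i => (Fin n → Coeff) [⋀^Fin i]→ₗ[Coeff] Coeff) n
        Matrix.detRowAlternating)).restrictScalars ℂ ∘ₗ (realization s).toLinearMap

theorem leadingCoeff_eq_zero {n : ℕ} {s τ : Fin n → ℤ} {N : ℤ} (hs : ∀ r, s r ≤ N - 2) {a : Fermion}
    (ha : a ∈ ann N) : leadingCoeff s τ a = 0 := by
  simp [leadingCoeff, realization_eq_zero hs ha]

theorem realization_prod {n m : ℕ} (s : Fin n → ℤ) (l : Fin m → ℤ ⊕ ℤ) :
    realization s ((List.ofFn l).map gen).prod =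
      ExteriorAlgebra.ιMulti Coeff m fun r => coord s (l r) := by
  rw [map_list_prod, List.map_map, List.map_ofFn, ExteriorAlgebra.ιMulti_apply]
  congr 2
  exact funext fun r => realization_gen s (l r)

theorem leadingCoeff_prod_of_ne {n m : ℕ} (h : m ≠ n) (s τ : Fin n → ℤ) (l : Fin m → ℤ ⊕ ℤ) :
    leadingCoeff s τ ((List.ofFn l).map gen).prod = 0 := by
  change MvPolynomial.coeff _ (ExteriorAlgebra.liftAlternating _ (realization s _)) = 0
  rw [realization_prod, ExteriorAlgebra.liftAlternating_apply_ιMulti, Pi.single_eq_of_ne h]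
  simp

-- In the Leibniz expansion of the determinant, each permutation contributes a sign times either
-- zero or a single product of variables with coefficient 1.
open Classical in
theorem leadingCoeff_prod {n : ℕ} (s τ : Fin n → ℤ) (l : Fin n → ℤ ⊕ ℤ) :
    leadingCoeff s τ ((List.ofFn l).map gen).prod =
      ∑ σ : Equiv.Perm (Fin n), (Equiv.Perm.sign σ : ℤ) *
        (if (∀ r, IsShift (l (σ r)) (s r - pos (l (σ r)))) ∧
          ∑ r, Finsupp.single (s r - pos (l (σ r))) 1 = ∑ r, Finsupp.single (τ r) 1
        then (1 : ℂ) else 0) := by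
  change MvPolynomial.coeff _ (ExteriorAlgebra.liftAlternating _ (realization s _)) = _
  rw [realization_prod, ExteriorAlgebra.liftAlternating_apply_ιMulti, Pi.single_eq_same,
    show Matrix.detRowAlternating (fun r => coord s (l r)) =
      (Matrix.of fun r => coord s (l r)).det from rfl,
    Matrix.det_apply', MvPolynomial.coeff_sum]
  refine Finset.sum_congr rfl fun σ _ => ?_
  have h : ∀ c : ℤ, (c : Coeff) = MvPolynomial.C (c : ℂ) := fun c => by simp
  rw [h, MvPolynomial.coeff_C_mul]
  simp only [Matrix.of_apply]
  congr 1
  by_cases hσ : ∀ r, IsShift (l (σ r)) (s r - pos (l (σ r)))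
  · have h1 : ∏ r, coord s (l (σ r)) r =
        MvPolynomial.monomial (∑ r, Finsupp.single (s r - pos (l (σ r))) 1) 1 := by
      rw [MvPolynomial.monomial_sum_one]
      exact Finset.prod_congr rfl fun r _ => if_pos (hσ r)
    rw [h1, MvPolynomial.coeff_monomial]
    simp [hσ]
  · rw [if_neg fun h => hσ h.1]
    obtain ⟨r, hr⟩ := not_forall.1 hσ
    rw [Finset.prod_eq_zero (Finset.mem_univ r) (amplitude_eq_zero hr)]
    simp

/-- The indices of `l` are `s - τ ∘ π` up to order, so only the mixed term `∑ s * (τ ∘ π)` of the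
sum of squares depends on `π`. As `s` increases and `τ` decreases, that term is least for `π = 1`,
which makes the sum of squares largest for `k`. -/
theorem sum_sq_lt_or_eq {n : ℕ} {s τ : Fin n → ℤ} (hs : StrictMono s) (hτ : Antitone τ)
    {k l : Fin n → ℤ ⊕ ℤ} (hk : ∀ r, IsShift (k r) (τ r)) (hpos : ∀ r, s r = pos (k r) + τ r)
    {σ : Equiv.Perm (Fin n)} (hσ : ∀ r, IsShift (l (σ r)) (s r - pos (l (σ r))))
    (hsum : ∑ r, Finsupp.single (s r - pos (l (σ r))) 1 = ∑ r, Finsupp.single (τ r) (1 : ℕ)) :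
    ∑ r, pos (l r) ^ 2 < ∑ r, pos (k r) ^ 2 ∨ l ∘ σ = k := by
  obtain ⟨π, hπ⟩ := exists_perm_of_sum_single hsum
  have hl : ∀ r, pos (l (σ r)) = s r - τ (π r) := fun r => by
    have := congrFun hπ r
    simp only [Function.comp_apply] at this
    omega
  have hanti : Antivary s τ := hτ.antivary hs.monotone |>.symm
  have hle := hanti.sum_mul_le_sum_mul_comp_perm (σ := π)
  have h1 : ∑ r, pos (l r) ^ 2 = ∑ r, s r ^ 2 + ∑ r, τ r ^ 2 - 2 * ∑ r, s r * τ (π r) := by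
    rw [← Equiv.sum_comp σ, ← Equiv.sum_comp π (fun r => τ r ^ 2), Finset.mul_sum,
      ← Finset.sum_add_distrib, ← Finset.sum_sub_distrib]
    refine Finset.sum_congr rfl fun r _ => ?_
    rw [hl]
    ring
  have h2 : ∑ r, pos (k r) ^ 2 = ∑ r, s r ^ 2 + ∑ r, τ r ^ 2 - 2 * ∑ r, s r * τ r := by
    rw [Finset.mul_sum, ← Finset.sum_add_distrib, ← Finset.sum_sub_distrib]
    refine Finset.sum_congr rfl fun r _ => ?_
    rw [hpos]
    ring
  rcases hle.lt_or_eq with h | h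
  · left
    omega
  · right
    -- Equality in the rearrangement inequality forces `τ ∘ π` to be ordered oppositely to `s`; as
    -- `s` is strictly increasing, `τ ∘ π` is then the decreasing rearrangement, namely `τ`.
    have hπτ : Antitone (τ ∘ π) := fun a b hab => by
      rcases hab.eq_or_lt with rfl | hab
      · exact le_rfl
      · by_contra hlt
        exact (hanti.sum_mul_eq_sum_mul_comp_perm_iff.1 h.symm (not_le.1 hlt)).not_gt (hs hab)
    have heq : τ ∘ π = τ := Tuple.unique_antitone (σ := π) (τ := 1) hπτ hτ
    refine funext fun r => ?_
    have hr : pos (l (σ r)) = pos (k r) := by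
      have h3 := congrFun heq r
      have h4 := hpos r
      have h5 := hl r
      simp only [Function.comp_apply] at h3
      omega
    have hσr := hσ r
    rw [hr, show s r - pos (k r) = τ r by have := hpos r; omega] at hσr
    have hkr := hk r
    simp only [Function.comp_apply]
    revert hr hσr hkr
    -- The parity of the common shift tells an `x` from a `y`.
    rcases l (σ r) with i | i <;> rcases k r with j | j <;> intro hr hσr hkr
    · exact congrArg Sum.inl hr
    · exact absurd hσr.1 (Int.not_even_iff_odd.2 hkr.1)
    · exact absurd hkr.1 (Int.not_even_iff_odd.2 hσr.1)
    · exact congrArg Sum.inr hr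

open Classical in
theorem sum_sq_lt_or_of_leadingCoeff_ne_zero {n : ℕ} {s τ : Fin n → ℤ} (hs : StrictMono s)
    (hτ : Antitone τ) {k : Fin n → ℤ ⊕ ℤ} (hk : ∀ r, IsShift (k r) (τ r))
    (hpos : ∀ r, s r = pos (k r) + τ r) {L : List (ℤ ⊕ ℤ)}
    (hL : leadingCoeff s τ (L.map gen).prod ≠ 0) :
    (L.map fun a => pos a ^ 2).sum < ∑ r, pos (k r) ^ 2 ∨ ∀ a, a ∈ L ↔ ∃ r, k r = a := by
  obtain ⟨m, l, rfl⟩ : ∃ (m : ℕ) (l : Fin m → ℤ ⊕ ℤ), L = List.ofFn l :=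
    ⟨_, L.get, (List.ofFn_get L).symm⟩
  by_cases hm : m = n
  · subst hm
    rw [leadingCoeff_prod] at hL
    obtain ⟨σ, -, hσ⟩ := Finset.exists_ne_zero_of_sum_ne_zero hL
    have hσ' := (ite_ne_right_iff.1 (right_ne_zero_of_mul hσ)).1
    rcases sum_sq_lt_or_eq hs hτ hk hpos hσ'.1 hσ'.2 with h | h
    · left
      rwa [List.map_ofFn, List.sum_ofFn]
    · right
      intro a
      rw [List.mem_ofFn, ← h]
      exact (σ.surjective.exists (p := fun r => l r = a))
  · exact absurd (leadingCoeff_prod_of_ne hm s τ l) hL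

-- Only the permutation that matches the factors of `L` with those of `k` contributes: another one
-- would have to yield the same factor in each place, and the factors are distinct. The coefficient
-- is therefore a sign.
open Classical in
theorem leadingCoeff_ne_zero {n : ℕ} {s τ : Fin n → ℤ} (hs : StrictMono s)
    (hτ : Antitone τ) {k : Fin n → ℤ ⊕ ℤ} (hk : ∀ r, IsShift (k r) (τ r))
    (hpos : ∀ r, s r = pos (k r) + τ r) {L : List (ℤ ⊕ ℤ)} (hL : L.Nodup)
    (hkL : L.Perm (List.ofFn k)) : leadingCoeff s τ (L.map gen).prod ≠ 0 := by
  obtain ⟨m, l, rfl⟩ : ∃ (m : ℕ) (l : Fin m → ℤ ⊕ ℤ), L = List.ofFn l :=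
    ⟨_, L.get, (List.ofFn_get L).symm⟩
  obtain rfl : m = n := by simpa using hkL.length_eq
  have hl : Function.Injective l := List.nodup_ofFn.1 hL
  have hki : Function.Injective k := List.nodup_ofFn.1 (hkL.nodup_iff.1 hL)
  have hex : ∀ r, ∃ r', l r' = k r := fun r =>
    List.mem_ofFn.1 (hkL.mem_iff.2 (List.mem_ofFn.2 ⟨r, rfl⟩))
  choose f hf using hex
  have hfi : Function.Injective f := fun a b hab => hki (by rw [← hf, ← hf, hab])
  let σ : Equiv.Perm (Fin m) := Equiv.ofBijective f (Finite.injective_iff_bijective.1 hfi)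
  have hσ : ∀ r, l (σ r) = k r := hf
  rw [leadingCoeff_prod, Finset.sum_eq_single_of_mem σ (Finset.mem_univ σ)]
  · rw [if_pos]
    · simp
    · simp only [hσ]
      have h : ∀ r, s r - pos (k r) = τ r := fun r => by rw [hpos]; ring
      simp only [h]
      exact ⟨hk, trivial⟩
  · intro σ' _ hne
    rw [if_neg, mul_zero]
    rintro ⟨h1, h2⟩
    rcases sum_sq_lt_or_eq hs hτ hk hpos h1 h2 with h | h
    · rw [← Equiv.sum_comp σ] at h
      simp only [hσ] at h
      exact lt_irrefl _ h
    · exact hne (Equiv.ext fun r => hl ((congrFun h r).trans (hσ r).symm))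

/-! ### Linear independence of the configurations -/

/-- The factors of `monomial I J`. -/
def letters (I J : Finset ℤ) : List (ℤ ⊕ ℤ) :=
  (I.sort (· ≤ ·)).map Sum.inl ++ (J.sort (· ≤ ·)).map Sum.inr

theorem monomial_eq_prod (I J : Finset ℤ) : monomial I J = ((letters I J).map gen).prod := by
  rw [letters, List.map_append, List.prod_append, List.map_map, List.map_map]
  rfl

theorem nodup_letters (I J : Finset ℤ) : (letters I J).Nodup := by
  refine List.Nodup.append ((Finset.sort_nodup _ _).map Sum.inl_injective)
    ((Finset.sort_nodup _ _).map Sum.inr_injective) ?_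
  intro a h1 h2
  obtain ⟨_, -, rfl⟩ := List.mem_map.1 h1
  obtain ⟨_, -, h⟩ := List.mem_map.1 h2
  cases h

theorem inl_mem_letters {I J : Finset ℤ} {i : ℤ} : Sum.inl i ∈ letters I J ↔ i ∈ I := by
  simp [letters]

theorem inr_mem_letters {I J : Finset ℤ} {j : ℤ} : Sum.inr j ∈ letters I J ↔ j ∈ J := by
  simp [letters]

theorem eq_of_mem_letters_iff {I J I' J' : Finset ℤ}
    (h : ∀ a, a ∈ letters I J ↔ a ∈ letters I' J') : I = I' ∧ J = J' :=
  ⟨Finset.ext fun _ => inl_mem_letters.symm.trans ((h _).trans inl_mem_letters),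
    Finset.ext fun _ => inr_mem_letters.symm.trans ((h _).trans inr_mem_letters)⟩

/-- For each basis monomial there is a functional on `Υ(N)` that does not vanish on it, but vanishes
on all other ones with an at least as large sum of squares of the indices. -/
theorem exists_functional {N : ℤ} {I J : Finset ℤ} (h : IsConfiguration N I J) :
    ∃ F : Fermion →ₗ[ℂ] ℂ, (∀ a ∈ ann N, F a = 0) ∧ F (monomial I J) ≠ 0 ∧
      ∀ I' J', F (monomial I' J') ≠ 0 →
        ((letters I' J').map fun a => pos a ^ 2).sum < ((letters I J).map fun a => pos a ^ 2).sum ∨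
          I' = I ∧ J' = J := by
  let κ : ℤ → ℤ ⊕ ℤ := fun u => if u ∈ I then Sum.inl u else Sum.inr u
  have hdisj : ∀ u ∈ I, u ∉ J := fun u hI hJ => by
    have := h.two_le u hI u hJ
    simp at this
  have hκI : ∀ u ∈ I, κ u = Sum.inl u := fun u hu => if_pos hu
  have hκJ : ∀ u ∈ J, κ u = Sum.inr u := fun u hu => if_neg fun hI => hdisj u hI hu
  have hposκ : ∀ u, pos (κ u) = u := fun u => by
    by_cases hu : u ∈ I
    · rw [hκI u hu]; rfl
    · rw [show κ u = Sum.inr u from if_neg hu]; rfl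
  obtain ⟨τ, hτ⟩ := exists_shift N κ (I ∪ J) (by
    intro u hu t ht ht0
    rcases Finset.mem_union.1 hu with hu | hu
    · have := h.lt_x u hu
      omega
    -- A nonpositive shift of a `y` is odd, hence at most -1, so that `u ≤ N - 1` suffices.
    · have := h.lt_y u hu
      rw [hκJ u hu] at ht
      have h1 : Odd t := ht.1
      have : t ≠ 0 := by rintro rfl; simp at h1
      omega) (by
    intro u hu v hv huv
    rcases Finset.mem_union.1 hu with hu | hu <;> rcases Finset.mem_union.1 hv with hv | hv
    · simp [hκI u hu, hκI v hv] at huv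
    · exact h.two_le u hu v hv
    · rw [abs_sub_comm]
      exact h.two_le v hv u hu
    · simp [hκJ u hu, hκJ v hv] at huv)
  let e := (I ∪ J).orderEmbOfFin rfl
  have he : ∀ r, e r ∈ I ∪ J := fun r => Finset.orderEmbOfFin_mem _ rfl r
  have hs : StrictMono fun r => e r + τ (e r) := fun a b hab =>
    ((hτ _ (he a)).2.2 _ (he b) (e.strictMono hab)).2
  have hanti : Antitone fun r => τ (e r) := fun a b hab => by
    rcases hab.eq_or_lt with rfl | hab
    · exact le_rfl
    · exact ((hτ _ (he a)).2.2 _ (he b) (e.strictMono hab)).1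
  have hk : ∀ r, IsShift (κ (e r)) (τ (e r)) := fun r => (hτ _ (he r)).1
  have hpos : ∀ r, e r + τ (e r) = pos (κ (e r)) + τ (e r) := fun r => by rw [hposκ]
  have hκi : Function.Injective fun r => κ (e r) := fun a b hab =>
    e.injective (by rw [← hposκ (e a), ← hposκ (e b)]; exact congrArg pos hab)
  have hmem : ∀ a, a ∈ letters I J ↔ ∃ r, κ (e r) = a := by
    have hr : ∀ u, u ∈ I ∪ J ↔ ∃ r, e r = u := fun u => by
      rw [← Finset.mem_coe, ← Finset.range_orderEmbOfFin (I ∪ J) rfl]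
      exact Iff.rfl
    rintro (u | u)
    · rw [inl_mem_letters]
      constructor
      · intro hu
        obtain ⟨r, hr⟩ := (hr u).1 (Finset.mem_union_left _ hu)
        exact ⟨r, by rw [hr, hκI u hu]⟩
      · rintro ⟨r, hr⟩
        rcases Finset.mem_union.1 (he r) with h | h
        · rw [hκI _ h] at hr
          exact Sum.inl_injective hr ▸ h
        · rw [hκJ _ h] at hr
          cases hr
    · rw [inr_mem_letters]
      constructor
      · intro hu
        obtain ⟨r, hr⟩ := (hr u).1 (Finset.mem_union_right _ hu)
        exact ⟨r, by rw [hr, hκJ u hu]⟩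
      · rintro ⟨r, hr⟩
        rcases Finset.mem_union.1 (he r) with h | h
        · rw [hκI _ h] at hr
          cases hr
        · rw [hκJ _ h] at hr
          exact Sum.inr_injective hr ▸ h
  have hperm : (letters I J).Perm (List.ofFn fun r => κ (e r)) :=
    (List.perm_ext_iff_of_nodup (nodup_letters I J) (List.nodup_ofFn.2 hκi)).2 fun a => by
      rw [hmem, List.mem_ofFn]
  refine ⟨leadingCoeff (fun r => e r + τ (e r)) (fun r => τ (e r)),
    fun a ha => leadingCoeff_eq_zero (fun r => (hτ _ (he r)).2.1) ha, ?_, fun I' J' h' => ?_⟩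
  · rw [monomial_eq_prod]
    exact leadingCoeff_ne_zero hs hanti hk hpos (nodup_letters I J) hperm
  · rw [monomial_eq_prod] at h'
    rw [(hperm.map fun a => pos a ^ 2).sum_eq, List.map_ofFn, List.sum_ofFn]
    refine (sum_sq_lt_or_of_leadingCoeff_ne_zero hs hanti hk hpos h').imp_right fun h'' => ?_
    exact eq_of_mem_letters_iff fun a => (h'' a).trans (hmem a).symm

/-- Among the terms of a dependency with nonzero coefficient, one with the least sum of squares is
isolated by its functional, which kills all the others. -/
theorem linearIndependent_monomial (N : ℤ) : LinearIndependent ℂ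
    fun p : {p : Finset ℤ × Finset ℤ // IsConfiguration N p.1 p.2} =>
      monomial p.1.1 p.1.2 • extremeVector N := by
  rw [linearIndependent_iff']
  intro S g hg
  by_contra! hne
  obtain ⟨p₀, hp₀, hg₀⟩ := hne
  obtain ⟨p, hp, hmin⟩ := (S.filter fun p => g p ≠ 0).exists_min_image
    (fun p => ((letters p.1.1 p.1.2).map fun a => pos a ^ 2).sum)
    ⟨p₀, Finset.mem_filter.2 ⟨hp₀, hg₀⟩⟩
  rw [Finset.mem_filter] at hp
  obtain ⟨F, hF, hFp, hF'⟩ := exists_functional p.2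
  have h0 : ∑ p ∈ S, g p • monomial p.1.1 p.1.2 ∈ ann N := by
    rw [← Submodule.Quotient.mk_eq_zero, ← smul_extremeVector, Finset.sum_smul, ← hg]
    exact Finset.sum_congr rfl fun q _ => smul_assoc _ _ _
  have h1 := hF _ h0
  rw [map_sum, Finset.sum_eq_single_of_mem p hp.1, map_smul, smul_eq_mul] at h1
  · exact (mul_ne_zero hp.2 hFp) h1
  · intro q hq hqp
    rw [map_smul, smul_eq_mul]
    by_contra h2
    rcases hF' _ _ (right_ne_zero_of_mul h2) with h3 | ⟨h3, h4⟩
    · exact (hmin q (Finset.mem_filter.2 ⟨hq, left_ne_zero_of_mul h2⟩)).not_gt h3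
    · exact hqp (Subtype.ext (Prod.ext h3 h4))

/-! ### Rewriting by the relations, and spanning -/

/-- Adding `(-1) ^ i` times the alternating relation to the plain one doubles the terms with index
of the parity of `i` and cancels the rest. -/
theorem sum_filter_even_eq_zero {V : Type*} [AddCommGroup V] [Module ℂ V] {S : Finset ℤ} {f : ℤ → V}
    (h1 : ∑ a ∈ S, f a = 0) (h2 : ∑ a ∈ S, ((-1 : ℂ) ^ a) • f a = 0) (i : ℤ) :
    ∑ a ∈ S.filter (fun a => Even (a - i)), f a = 0 := by
  have h3 : (2 : ℂ) • ∑ a ∈ S.filter (fun a => Even (a - i)), f a =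
      ∑ a ∈ S, f a + ((-1 : ℂ) ^ i) • ∑ a ∈ S, ((-1 : ℂ) ^ a) • f a := by
    rw [Finset.smul_sum, Finset.smul_sum, ← Finset.sum_add_distrib, Finset.sum_filter]
    refine Finset.sum_congr rfl fun a _ => ?_
    rw [smul_smul, ← zpow_add₀ (by norm_num : (-1 : ℂ) ≠ 0),
      show i + a = (a - i) + 2 * i by ring, zpow_add₀ (by norm_num : (-1 : ℂ) ≠ 0),
      (even_two_mul i).neg_one_zpow, mul_one]
    split_ifs with h
    · rw [h.neg_one_zpow, one_smul, two_smul]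
    · rw [(Int.not_even_iff_odd.1 h).neg_one_zpow, neg_one_smul, add_neg_cancel]
  rw [h1, h2, smul_zero, add_zero] at h3
  exact (smul_eq_zero_iff_right two_ne_zero).1 h3

/-- The relations express the product of an `x` and a `y` with adjacent indices by products of
the same energy with a larger sum of squares of the indices. -/
theorem exists_rewrite {N : ℤ} (v : Upsilon N) {i j : ℤ} (hij : |i - j| < 2) :
    ∃ F : Finset ℤ, (∀ a ∈ F, i ^ 2 + j ^ 2 < a ^ 2 + (-a + (i + j)) ^ 2) ∧
      x i • y j • v = -∑ a ∈ F, x a • y (-a + (i + j)) • v := by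
  have hij' := abs_lt.1 hij
  by_cases hi : N - 1 ≤ i
  · exact ⟨∅, by simp, by rw [x_smul_eq_zero hi]; simp⟩
  by_cases hj : N ≤ j
  · exact ⟨∅, by simp, by rw [y_smul_eq_zero hj]; simp⟩
  have hmem : i ∈ Finset.Icc (i + j - N + 1) (N - 2) := Finset.mem_Icc.2 (by omega)
  have h1 := relator_smul_eq_zero N (i + j) v
  rw [relator, Finset.sum_smul] at h1
  simp only [mul_smul] at h1
  suffices h : ∃ F : Finset ℤ, i ∈ F ∧ (∀ a ∈ F, a ≠ i → i ^ 2 + j ^ 2 < a ^ 2 + (-a + (i + j)) ^ 2) ∧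
      ∑ a ∈ F, x a • y (-a + (i + j)) • v = 0 by
    obtain ⟨F, hiF, hF, h0⟩ := h
    refine ⟨F.erase i, fun a ha => hF a (Finset.mem_of_mem_erase ha) (Finset.ne_of_mem_erase ha), ?_⟩
    rw [← Finset.add_sum_erase F _ hiF, neg_add_cancel_left] at h0
    exact eq_neg_of_add_eq_zero_left h0
  rcases Int.even_or_odd' (i + j) with ⟨s, hs | hs⟩
  · refine ⟨_, hmem, fun a _ ha => ?_, h1⟩
    -- Even energy and distance below 2 leave only `i = j`; the sum of squares then grows by `2 * (a
    -- - i) ^ 2`.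
    obtain rfl : i = j := by omega
    have : 0 < (a - i) ^ 2 := by
      have := sub_ne_zero.2 ha
      positivity
    nlinarith
  · have h2 := relatorAlt_smul_eq_zero N s v
    rw [relatorAlt, Finset.sum_smul] at h2
    simp only [add_assoc _ (2 * s) (1 : ℤ), ← hs, smul_assoc, mul_smul] at h2
    refine ⟨(Finset.Icc (i + j - N + 1) (N - 2)).filter fun a => Even (a - i),
      Finset.mem_filter.2 ⟨hmem, by simp⟩, fun a ha hai => ?_, ?_⟩
    · obtain ⟨d, hd⟩ := (Finset.mem_filter.1 ha).2
      obtain rfl : a = i + (d + d) := by omega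
      have hd0 : d ≠ 0 := by rintro rfl; simp at hai
      -- With `a = i + 2 * d` the sum of squares grows by `8 * d ^ 2 + 4 * d * (i - j)`, which is
      -- positive for every nonzero integer `d`.
      obtain h | h : i - j = 1 ∨ i - j = -1 := by omega
      · obtain rfl : i = j + 1 := by omega
        rcases lt_or_gt_of_ne hd0 with h | h <;> nlinarith
      · obtain rfl : j = i + 1 := by omega
        rcases lt_or_gt_of_ne hd0 with h | h <;> nlinarith
    · exact sum_filter_even_eq_zero h1 h2 i

theorem exists_perm_cons {α : Type*} {L : List α} {a : α} (h : a ∈ L) :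
    ∃ L', L.Perm (a :: L') := by
  obtain ⟨L₁, L₂, rfl⟩ := List.append_of_mem h
  exact ⟨_, List.perm_middle⟩

/-- A permutation of the factors changes a product of generators by a scalar. -/
theorem exists_prod_eq_smul {L L' : List (ℤ ⊕ ℤ)} (h : L.Perm L') :
    ∃ r : ℂ, (L.map gen).prod = r • (L'.map gen).prod := by
  induction h with
  | nil => exact ⟨1, (one_smul _ _).symm⟩
  | cons a _ ih =>
    obtain ⟨r, hr⟩ := ih
    exact ⟨r, by rw [List.map_cons, List.map_cons, List.prod_cons, List.prod_cons, hr, mul_smul_comm]⟩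
  | swap a b L =>
    refine ⟨-1, ?_⟩
    simp only [List.map_cons, List.prod_cons, neg_one_smul]
    rw [← mul_assoc, gen_mul_gen, neg_mul, mul_assoc]
  | trans _ _ ih ih' =>
    obtain ⟨r, hr⟩ := ih
    obtain ⟨r', hr'⟩ := ih'
    exact ⟨r * r', by rw [hr, hr', smul_smul]⟩

theorem prod_smul_mem_of_perm {N : ℤ} {W : Submodule ℂ (Upsilon N)} {v : Upsilon N}
    {L L' : List (ℤ ⊕ ℤ)} (h : L.Perm L') (hW : (L'.map gen).prod • v ∈ W) :
    (L.map gen).prod • v ∈ W := by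
  obtain ⟨r, hr⟩ := exists_prod_eq_smul h
  rw [hr, smul_assoc]
  exact W.smul_mem r hW

/-- The cross terms of the square are nonnegative. Applied to the differences between `N` and the
indices, this bounds the sum of squares and makes the rewriting terminate. -/
theorem sum_sq_le_sq_sum {α : Type*} (f : α → ℤ) (L : List α) (h : ∀ a ∈ L, 0 ≤ f a) :
    0 ≤ (L.map f).sum ∧ (L.map fun a => f a ^ 2).sum ≤ (L.map f).sum ^ 2 := by
  induction L with
  | nil => simp
  | cons a L ih =>
    obtain ⟨h1, h2⟩ := ih fun b hb => h b (List.mem_cons_of_mem a hb)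
    have ha := h a List.mem_cons_self
    simp only [List.map_cons, List.sum_cons]
    exact ⟨by positivity, by nlinarith [mul_nonneg ha h1]⟩

/-- The span of the basis monomials. -/
noncomputable def configurationSpan (N : ℤ) : Submodule ℂ (Upsilon N) :=
  Submodule.span ℂ (Set.range
    fun p : {p : Finset ℤ × Finset ℤ // IsConfiguration N p.1 p.2} =>
      monomial p.1.1 p.1.2 • extremeVector N)

theorem prod_smul_mem_configurationSpan (N : ℤ) (L : List (ℤ ⊕ ℤ)) :
    (L.map gen).prod • extremeVector N ∈ configurationSpan N := by
  let f : ℤ ⊕ ℤ → ℤ := fun a => N - pos a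
  -- Rewriting preserves the sum of `f` and raises the sum of its squares, so this difference
  -- decreases. It is nonnegative whenever `f` is nonnegative on all factors, which fails only if
  -- some factor acts as zero.
  obtain ⟨m, hm⟩ : ∃ m : ℕ, (((L.map f).sum ^ 2 - (L.map fun a => f a ^ 2).sum).toNat = m) := ⟨_, rfl⟩
  induction m using Nat.strong_induction_on generalizing L with
  | _ m ih =>
  by_cases halive : ∃ a ∈ L, ∀ v : Upsilon N, gen a • v = 0
  · obtain ⟨a, ha, hv⟩ := halive
    obtain ⟨L', hL'⟩ := exists_perm_cons ha
    refine prod_smul_mem_of_perm hL' ?_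
    rw [List.map_cons, List.prod_cons, mul_smul, hv]
    exact zero_mem _
  push Not at halive
  have hx : ∀ i, Sum.inl i ∈ L → i < N - 1 := fun i hi => by
    by_contra h
    obtain ⟨v, hv⟩ := halive _ hi
    exact hv (x_smul_eq_zero (not_lt.1 h) v)
  have hy : ∀ j, Sum.inr j ∈ L → j < N := fun j hj => by
    by_contra h
    obtain ⟨v, hv⟩ := halive _ hj
    exact hv (y_smul_eq_zero (not_lt.1 h) v)
  by_cases hadj : ∃ i j, Sum.inl i ∈ L ∧ Sum.inr j ∈ L ∧ |i - j| < 2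
  · obtain ⟨i, j, hi, hj, hij⟩ := hadj
    obtain ⟨L', hL'⟩ : ∃ L', L.Perm (Sum.inl i :: Sum.inr j :: L') := by
      obtain ⟨L₁, h₁⟩ := exists_perm_cons hi
      have hj' : Sum.inr j ∈ L₁ := by simpa using h₁.mem_iff.1 hj
      obtain ⟨L₂, h₂⟩ := exists_perm_cons hj'
      exact ⟨L₂, h₁.trans (h₂.cons _)⟩
    refine prod_smul_mem_of_perm hL' ?_
    simp only [List.map_cons, List.prod_cons, mul_smul]
    obtain ⟨F, hF, h⟩ := exists_rewrite ((L'.map gen).prod • extremeVector N) hij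
    change x i • y j • _ ∈ _
    rw [h]
    refine neg_mem (sum_mem fun a ha => ?_)
    -- Terms with a new factor that acts as zero are discarded first, as the bound on the sum of
    -- squares does not cover them.
    by_cases hdead : N - 1 ≤ a
    · rw [x_smul_eq_zero hdead]
      exact zero_mem _
    by_cases hdead' : N ≤ -a + (i + j)
    · rw [y_smul_eq_zero hdead', smul_zero]
      exact zero_mem _
    have hmem : ((Sum.inl a :: Sum.inr (-a + (i + j)) :: L').map gen).prod • extremeVector N ∈
        configurationSpan N := by
      refine ih _ ?_ _ rfl
      have hsq := (sum_sq_le_sq_sum f (Sum.inl a :: Sum.inr (-a + (i + j)) :: L') (by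
        intro b hb
        have hb' : ∀ b ∈ L, 0 ≤ f b := by
          rintro (b | b) hb
          · have := hx b hb
            change 0 ≤ N - b
            omega
          · have := hy b hb
            change 0 ≤ N - b
            omega
        rcases List.mem_cons.1 hb with rfl | hb
        · change 0 ≤ N - a
          omega
        rcases List.mem_cons.1 hb with rfl | hb
        · change 0 ≤ N - (-a + (i + j))
          omega
        · exact hb' b (hL'.mem_iff.2 (List.mem_cons_of_mem _ (List.mem_cons_of_mem _ hb))))).2
      have hFa := hF a ha
      have h1 : (L.map f).sum = ((Sum.inl a :: Sum.inr (-a + (i + j)) :: L').map f).sum := by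
        rw [(hL'.map f).sum_eq]
        simp only [List.map_cons, List.sum_cons, f, pos, Sum.elim_inl, Sum.elim_inr, id]
        ring
      have h2 : (L.map fun a => f a ^ 2).sum <
          ((Sum.inl a :: Sum.inr (-a + (i + j)) :: L').map fun a => f a ^ 2).sum := by
        rw [(hL'.map fun a => f a ^ 2).sum_eq]
        simp only [List.map_cons, List.sum_cons, f, pos, Sum.elim_inl, Sum.elim_inr, id]
        linarith
      rw [h1] at hm
      omega
    simp only [List.map_cons, List.prod_cons, mul_smul] at hmem
    exact hmem
  push Not at hadj
  by_cases hnd : L.Nodup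
  · refine prod_smul_mem_of_perm (L' := letters L.toFinset.toLeft L.toFinset.toRight) ?_ ?_
    · refine (List.perm_ext_iff_of_nodup hnd (nodup_letters _ _)).2 ?_
      rintro (i | j)
      · rw [inl_mem_letters, Finset.mem_toLeft, List.mem_toFinset]
      · rw [inr_mem_letters, Finset.mem_toRight, List.mem_toFinset]
    · rw [← monomial_eq_prod]
      exact Submodule.subset_span ⟨⟨(L.toFinset.toLeft, L.toFinset.toRight),
        fun i hi => hx i (by simpa using hi), fun j hj => hy j (by simpa using hj),
        fun i hi j hj => hadj i j (by simpa using hi) (by simpa using hj)⟩, rfl⟩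
  · obtain ⟨a, ha⟩ : ∃ a, List.Duplicate a L := List.exists_duplicate_iff_not_nodup.2 hnd
    obtain ⟨L', hL'⟩ := (List.duplicate_iff_sublist.1 ha).exists_perm_append
    refine prod_smul_mem_of_perm hL' ?_
    change ((a :: a :: L').map gen).prod • _ ∈ _
    rw [List.map_cons, List.map_cons, List.prod_cons, List.prod_cons, ← mul_assoc, gen_mul_self,
      zero_mul, zero_smul]
    exact zero_mem _

/-- The products of generators applied to `γ_N` span a subspace that contains `γ_N` and is stable
under every generator, hence under the whole algebra. -/
theorem configurationSpan_eq_top (N : ℤ) : configurationSpan N = ⊤ := by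
  let P : Submodule ℂ (Upsilon N) := Submodule.span ℂ
    (Set.range fun L : List (ℤ ⊕ ℤ) => (L.map gen).prod • extremeVector N)
  have hgen : ∀ k, ∀ v ∈ P, gen k • v ∈ P := by
    intro k v hv
    induction hv using Submodule.span_induction with
    | mem v hv =>
      obtain ⟨L, rfl⟩ := hv
      exact Submodule.subset_span ⟨k :: L, by
        simp only [List.map_cons, List.prod_cons, mul_smul]⟩
    | zero => rw [smul_zero]; exact zero_mem P
    | add v w _ _ hv hw => rw [smul_add]; exact add_mem hv hw
    | smul r v _ hv => rw [smul_comm]; exact P.smul_mem r hv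
  have hP : ∀ a : Fermion, ∀ v ∈ P, a • v ∈ P := by
    intro a
    induction a using ExteriorAlgebra.induction with
    | algebraMap r => intro v hv; rw [algebraMap_smul]; exact P.smul_mem r hv
    | ι m =>
      intro v hv
      induction m using Finsupp.induction_linear with
      | zero => rw [map_zero, zero_smul]; exact zero_mem P
      | add f g hf hg => rw [map_add, add_smul]; exact add_mem hf hg
      | single k r =>
        rw [← Finsupp.smul_single_one, map_smul, smul_assoc]
        exact P.smul_mem r (hgen k v hv)
    | mul a b ha hb => intro v hv; rw [mul_smul]; exact ha _ (hb v hv)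
    | add a b ha hb => intro v hv; rw [add_smul]; exact add_mem (ha v hv) (hb v hv)
  have hle : P ≤ configurationSpan N := by
    refine Submodule.span_le.2 ?_
    rintro _ ⟨L, rfl⟩
    exact prod_smul_mem_configurationSpan N L
  rw [eq_top_iff]
  intro v _
  obtain ⟨a, rfl⟩ := exists_smul_extremeVector v
  exact hle (hP a _ (Submodule.subset_span ⟨[], by
    simp only [List.map_nil, List.prod_nil, one_smul]⟩))

/-! ### The basis and the map to the next level -/

/-- The basis of `Υ(N)`. -/
noncomputable def configurationBasis (N : ℤ) :
    Module.Basis {p : Finset ℤ × Finset ℤ // IsConfiguration N p.1 p.2} ℂ (Upsilon N) :=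
  Module.Basis.mk (linearIndependent_monomial N) (configurationSpan_eq_top N).ge

theorem configurationBasis_apply (N : ℤ)
    (p : {p : Finset ℤ × Finset ℤ // IsConfiguration N p.1 p.2}) :
    configurationBasis N p = monomial p.1.1 p.1.2 • extremeVector N :=
  Module.Basis.mk_apply _ _ p

/-- The bound `i ≤ N - 2` on the `x`-indices at level `N` is exactly the gap required from the new
`y`-index `N`. -/
theorem IsConfiguration.insert {N : ℤ} {I J : Finset ℤ} (h : IsConfiguration N I J) :
    IsConfiguration (N + 1) I (insert N J) where
  lt_x i hi := by
    have := h.lt_x i hi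
    omega
  lt_y j hj := by
    rcases Finset.mem_insert.1 hj with rfl | hj
    · omega
    · have := h.lt_y j hj
      omega
  two_le i hi j hj := by
    rcases Finset.mem_insert.1 hj with rfl | hj
    · have := h.lt_x i hi
      rw [abs_of_neg (by omega)]
      omega
    · exact h.two_le i hi j hj

theorem sort_insert_of_forall_lt {N : ℤ} {J : Finset ℤ} (h : ∀ j ∈ J, j < N) :
    (insert N J).sort (· ≤ ·) = J.sort (· ≤ ·) ++ [N] := by
  refine List.Perm.eq_of_pairwise' (r := (· ≤ ·)) ?_ ?_ ?_
  · exact (insert N J).pairwise_sort _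
  · refine List.pairwise_append.2 ⟨J.pairwise_sort _, List.pairwise_singleton _ _, ?_⟩
    intro a ha b hb
    rw [List.mem_singleton.1 hb]
    exact (h a ((Finset.mem_sort _).1 ha)).le
  · refine (List.perm_ext_iff_of_nodup (Finset.sort_nodup _ _) ?_).2 fun a => ?_
    · refine List.Nodup.append (Finset.sort_nodup _ _) (List.nodup_singleton _) ?_
      intro a ha hb
      rw [List.mem_singleton.1 hb] at ha
      exact lt_irrefl _ (h N ((Finset.mem_sort _).1 ha))
    · simp [or_comm]

/-- As `N` exceeds all `y`-indices, the factor `y N` that comes from the image of `γ_N` already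
stands in its sorted place at the right end, and no sign arises. -/
theorem transition_configurationBasis (N : ℤ)
    (p : {p : Finset ℤ × Finset ℤ // IsConfiguration N p.1 p.2}) :
    transition N (configurationBasis N p) =
      configurationBasis (N + 1) ⟨(p.1.1, insert N p.1.2), p.2.insert⟩ := by
  rw [configurationBasis_apply, configurationBasis_apply, map_smul, transition_extremeVector,
    ← mul_smul]
  congr 1
  simp only [monomial]
  rw [sort_insert_of_forall_lt p.2.lt_y, List.map_append, List.prod_append, mul_assoc]
  simp

theorem transition_injective (N : ℤ) : Function.Injective (transition N) := by
  let e : {p : Finset ℤ × Finset ℤ // IsConfiguration N p.1 p.2} →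
      {p : Finset ℤ × Finset ℤ // IsConfiguration (N + 1) p.1 p.2} :=
    fun p => ⟨(p.1.1, insert N p.1.2), p.2.insert⟩
  have he : Function.Injective e := by
    intro p q h
    have hN : ∀ p : {p : Finset ℤ × Finset ℤ // IsConfiguration N p.1 p.2}, N ∉ p.1.2 :=
      fun p hp => lt_irrefl _ (p.2.lt_y N hp)
    refine Subtype.ext (Prod.ext (show (e p).1.1 = (e q).1.1 by rw [h]) ?_)
    have h2 : insert N p.1.2 = insert N q.1.2 := show (e p).1.2 = (e q).1.2 by rw [h]
    rw [← Finset.erase_insert (hN p), h2, Finset.erase_insert (hN q)]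
  have h : LinearIndependent ℂ
      (((transition N).restrictScalars ℂ) ∘ (configurationBasis N)) := by
    have h' : ((transition N).restrictScalars ℂ) ∘ (configurationBasis N) =
        configurationBasis (N + 1) ∘ e := funext (transition_configurationBasis N)
    rw [h']
    exact (configurationBasis (N + 1)).linearIndependent.comp e he
  exact LinearMap.injective_of_linearIndependent (f := (transition N).restrictScalars ℂ) (configurationBasis N).span_eq h

end SqL

theorem lemma2 (N : ℤ) :
    (∃ b : Module.Basis {p : Finset ℤ × Finset ℤ // SqL.IsConfiguration N p.1 p.2} ℂ (SqL.Upsilon N),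
      ∀ p, b p = SqL.monomial p.1.1 p.1.2 • SqL.extremeVector N) ∧
    SqL.transition N (SqL.extremeVector N) = SqL.y N • SqL.extremeVector (N + 1) ∧
    Function.Injective (SqL.transition N) :=
  ⟨⟨SqL.configurationBasis N, SqL.configurationBasis_apply N⟩, SqL.transition_extremeVector N,
    SqL.transition_injective N⟩
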